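/- Let $(M,\omega)$ be a connected symplectic manifold (smooth, finite-dimensional, Hausdorff, without boundary; $\omega$ is a closed nondegenerate smooth $2$-form). Let $\mathfrak X(M)$ be the Lie algebra of smooth vector fields on $M$ and let $$\mathfrak X(M,[\omega]) := \{X\in\mathfrak X(M) : \text{there is } \lambda\in\mathbb R \text{ with } L_X\omega=\lambda\omega\}$$ be the Lie subalgebra of conformally symplectic vector fields. Then there is no Lie subalgebra $\mathfrak g$ of $\mathfrak X(M)$ with $\mathfrak X(M,[\omega])\subsetneq\mathfrak g\subseteq\mathfrak X(M)$ such that $\mathfrak X(M,[\omega])$ has finite codimension in $\mathfrak g$, that is, such that the real vector space $\mathfrak g/\mathfrak X(M,[\omega])$ is finite-dimensional. -/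

import Mathlib

open scoped Manifold ContDiff Bundle
open VectorField

namespace SymplecticManifold

section Defs

variable (E : Type*) [NormedAddCommGroup E] [NormedSpace ℝ E]
  (M : Type*) [TopologicalSpace M] [ChartedSpace E M] [IsManifold 𝓘(ℝ, E) ∞ M]

/-- The real vector space `𝔛(M)` of smooth vector fields on the smooth manifold `M` (without
boundary, modelled on `E`), i.e. of smooth sections of the tangent bundle. -/
abbrev SmoothVectorField : Type _ :=
  ContMDiffSection 𝓘(ℝ, E) E ∞ (fun x : M => TangentSpace 𝓘(ℝ, E) x)

/-- A smooth differential `2`-form on `M`: a smooth section of the bundle of bilinear forms on the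
tangent spaces, alternating at each point. -/
structure TwoForm where
  /-- the bilinear form at the point `x` -/
  toFun (x : M) : TangentSpace 𝓘(ℝ, E) x →L[ℝ] TangentSpace 𝓘(ℝ, E) x →L[ℝ] ℝ
  alternating (x : M) (v : TangentSpace 𝓘(ℝ, E) x) : toFun x v v = 0
  smooth : ContMDiff 𝓘(ℝ, E) (𝓘(ℝ, E).prod 𝓘(ℝ, E →L[ℝ] E →L[ℝ] ℝ)) ∞
    (fun x => Bundle.TotalSpace.mk' (E →L[ℝ] E →L[ℝ] ℝ)
      (E := fun x : M =>
        (TangentSpace 𝓘(ℝ, E) x →L[ℝ] TangentSpace 𝓘(ℝ, E) x →L[ℝ] ℝ)) x (toFun x))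

variable {E M}

/-- The derivative `X f` of the function `f` along the vector field `X`. -/
noncomputable def dirDeriv (X : SmoothVectorField E M) (f : M → ℝ) (x : M) : ℝ :=
  mvfderiv 𝓘(ℝ, E) f x (X x)

/-- The function `α(Y, Z)`. -/
noncomputable def TwoForm.eval (α : TwoForm E M) (Y Z : SmoothVectorField E M) (x : M) : ℝ :=
  α.toFun x (Y x) (Z x)

end Defs

section Bracket

variable {E : Type*} [NormedAddCommGroup E] [NormedSpace ℝ E]
  {M : Type*} [TopologicalSpace M] [ChartedSpace E M] [IsManifold 𝓘(ℝ, E) ∞ M]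

theorem SmoothVectorField.mdifferentiableAt (X : SmoothVectorField E M) (x : M) :
    MDifferentiableAt 𝓘(ℝ, E) (𝓘(ℝ, E).prod 𝓘(ℝ, E))
      (fun y => (Bundle.TotalSpace.mk' E y (X y) : TangentBundle 𝓘(ℝ, E) M)) x :=
  (X.contMDiff x).mdifferentiableAt (by simp)

theorem isManifold_two : IsManifold 𝓘(ℝ, E) (minSmoothness ℝ 2) M := by
  simp only [minSmoothness_of_isRCLikeNormedField]
  infer_instance

theorem isManifold_three : IsManifold 𝓘(ℝ, E) (minSmoothness ℝ 3) M := by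
  simp only [minSmoothness_of_isRCLikeNormedField]
  infer_instance

theorem contMDiff_dirDeriv (X : SmoothVectorField E M) {f : M → ℝ}
    (hf : ContMDiff 𝓘(ℝ, E) 𝓘(ℝ, ℝ) ∞ f) :
    ContMDiff 𝓘(ℝ, E) 𝓘(ℝ, ℝ) ∞ (dirDeriv X f) := by
  have h1 : ContMDiff 𝓘(ℝ, E).tangent 𝓘(ℝ, ℝ).tangent ∞ (tangentMap 𝓘(ℝ, E) 𝓘(ℝ, ℝ) f) :=
    hf.contMDiff_tangentMap (by simp)
  exact (contMDiff_snd_tangentBundle_modelSpace ℝ 𝓘(ℝ, ℝ)).comp (h1.comp X.contMDiff)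

theorem TwoForm.contMDiff_eval (α : TwoForm E M) (Y Z : SmoothVectorField E M) :
    ContMDiff 𝓘(ℝ, E) 𝓘(ℝ, ℝ) ∞ (α.eval Y Z) := by
  have h := ContMDiff.clm_bundle_apply₂ (E₁ := fun x : M => TangentSpace 𝓘(ℝ, E) x)
    (E₂ := fun x : M => TangentSpace 𝓘(ℝ, E) x) (E₃ := Bundle.Trivial M ℝ) (F₁ := E) (F₂ := E)
    (F₃ := ℝ) (b := id) (ψ := α.toFun) (v := Y) (w := Z) α.smooth Y.contMDiff Z.contMDiff
  intro x
  have := h x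
  simp only [Bundle.contMDiffAt_totalSpace] at this
  simpa using! this.2

variable [FiniteDimensional ℝ E]

/-- The Lie bracket of vector fields. -/
noncomputable instance : Bracket (SmoothVectorField E M) (SmoothVectorField E M) where
  bracket X Y :=
    { toFun := mlieBracket 𝓘(ℝ, E) X Y
      contMDiff_toFun := by
        have : CompleteSpace E := FiniteDimensional.complete ℝ E
        have := isManifold_two (E := E) (M := M)
        have : IsManifold 𝓘(ℝ, E) ((⊤ : ℕ∞) + 1) M := by simpa using! ‹IsManifold 𝓘(ℝ, E) ∞ M›
        exact fun x => ContMDiffAt.mlieBracket_vectorField (m := ⊤) (n := ⊤)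
          (X.contMDiff x) (Y.contMDiff x) (by simp) }

theorem bracket_apply (X Y : SmoothVectorField E M) (x : M) :
    ⁅X, Y⁆ x = mlieBracket 𝓘(ℝ, E) X Y x := rfl

noncomputable instance : LieRing (SmoothVectorField E M) where
  add_lie X Y Z := by
    have : CompleteSpace E := FiniteDimensional.complete ℝ E
    have := isManifold_two (E := E) (M := M)
    ext x
    exact mlieBracket_add_left (X.mdifferentiableAt x) (Y.mdifferentiableAt x)
  lie_add X Y Z := by
    have : CompleteSpace E := FiniteDimensional.complete ℝ E
    have := isManifold_two (E := E) (M := M)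
    ext x
    exact mlieBracket_add_right (Y.mdifferentiableAt x) (Z.mdifferentiableAt x)
  lie_self X := by
    ext x
    simp [bracket_apply]
  leibniz_lie X Y Z := by
    have : CompleteSpace E := FiniteDimensional.complete ℝ E
    have := isManifold_three (E := E) (M := M)
    ext x
    have h2 : minSmoothness ℝ 2 ≤ ∞ := by simpa using! ENat.LEInfty.out (m := 2)
    exact leibniz_identity_mlieBracket_apply ((X.contMDiff x).of_le h2)
      ((Y.contMDiff x).of_le h2) ((Z.contMDiff x).of_le h2)

noncomputable instance : LieAlgebra ℝ (SmoothVectorField E M) where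
  lie_smul c X Y := by
    have : CompleteSpace E := FiniteDimensional.complete ℝ E
    have := isManifold_two (E := E) (M := M)
    ext x
    exact mlieBracket_const_smul_right (Y.mdifferentiableAt x)

theorem dirDeriv_bracket (X Y : SmoothVectorField E M) {f : M → ℝ}
    (hf : ContMDiff 𝓘(ℝ, E) 𝓘(ℝ, ℝ) ∞ f) (x : M) :
    dirDeriv ⁅X, Y⁆ f x = dirDeriv X (dirDeriv Y f) x - dirDeriv Y (dirDeriv X f) x := by
  have : CompleteSpace E := FiniteDimensional.complete ℝ E
  have := isManifold_two (E := E) (M := M)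
  have := isManifold_three (E := E) (M := M)
  have hfd (y : M) : MDifferentiableAt 𝓘(ℝ, E) 𝓘(ℝ, ℝ) f y := (hf y).mdifferentiableAt (by simp)
  have hXf (y : M) : MDifferentiableAt 𝓘(ℝ, E) 𝓘(ℝ, ℝ) (dirDeriv X f) y :=
    (contMDiff_dirDeriv X hf y).mdifferentiableAt (by simp)
  have hYf (y : M) : MDifferentiableAt 𝓘(ℝ, E) 𝓘(ℝ, ℝ) (dirDeriv Y f) y :=
    (contMDiff_dirDeriv Y hf y).mdifferentiableAt (by simp)
  -- Compare coefficients of `W` in the Jacobi identity for `X`, `Y`, `f W`.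
  by_cases hE : Subsingleton (TangentSpace 𝓘(ℝ, E) x)
  · have hz (U : SmoothVectorField E M) (g : M → ℝ) : dirDeriv U g x = 0 := by
      rw [dirDeriv, Subsingleton.elim (U x) 0, map_zero]
    simp [hz]
  rw [not_subsingleton_iff_nontrivial] at hE
  obtain ⟨w, hw⟩ := exists_ne (0 : TangentSpace 𝓘(ℝ, E) x)
  let W : (y : M) → TangentSpace 𝓘(ℝ, E) y := FiberBundle.extend E w
  have hWx : W x = w := by simp [W]
  have hW : ContMDiffAt 𝓘(ℝ, E) (𝓘(ℝ, E).prod 𝓘(ℝ, E)) ∞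
      (fun y => (Bundle.TotalSpace.mk' E y (W y) : TangentBundle 𝓘(ℝ, E) M)) x :=
    FiberBundle.contMDiffAt_extend 𝓘(ℝ, E) E w
  have hWd := hW.mdifferentiableAt (by simp)
  have hWev : ∀ᶠ y in nhds x, MDifferentiableAt 𝓘(ℝ, E) (𝓘(ℝ, E).prod 𝓘(ℝ, E))
      (fun y => (Bundle.TotalSpace.mk' E y (W y) : TangentBundle 𝓘(ℝ, E) M)) y := by
    obtain ⟨t, ht, htW⟩ := FiberBundle.exists_mdifferentiableOn_extend 𝓘(ℝ, E) E w
    filter_upwards [eventually_mem_nhds_iff.2 ht] with y hy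
    exact (htW y (mem_of_mem_nhds hy)).mdifferentiableAt hy
  have : IsManifold 𝓘(ℝ, E) ((⊤ : ℕ∞) + 1) M := by simpa using! ‹IsManifold 𝓘(ℝ, E) ∞ M›
  have hB (U : SmoothVectorField E M) : MDifferentiableAt 𝓘(ℝ, E) (𝓘(ℝ, E).prod 𝓘(ℝ, E))
      (fun y => (Bundle.TotalSpace.mk' E y (mlieBracket 𝓘(ℝ, E) U W y) :
        TangentBundle 𝓘(ℝ, E) M)) x :=
    (ContMDiffAt.mlieBracket_vectorField (m := ⊤) (n := ⊤)
          (U.contMDiff x) hW (by simp)).mdifferentiableAt (by simp)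
  have hfW : ContMDiffAt 𝓘(ℝ, E) (𝓘(ℝ, E).prod 𝓘(ℝ, E)) ∞
      (fun y => (Bundle.TotalSpace.mk' E y ((f • W) y) : TangentBundle 𝓘(ℝ, E) M)) x :=
    (hf x).smul_section hW
  have hb (U : SmoothVectorField E M) :
      mlieBracket 𝓘(ℝ, E) U (f • W) =ᶠ[nhds x]
        dirDeriv U f • W + f • mlieBracket 𝓘(ℝ, E) U W := by
    filter_upwards [hWev] with y hy
    exact mlieBracket_smul_right (hfd y) hy
  have hbb (U V : SmoothVectorField E M) :
      mlieBracket 𝓘(ℝ, E) U (mlieBracket 𝓘(ℝ, E) V (f • W)) x =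
        (dirDeriv U (dirDeriv V f) x • W x + dirDeriv V f x • mlieBracket 𝓘(ℝ, E) U W x) +
        (dirDeriv U f x • mlieBracket 𝓘(ℝ, E) V W x +
          f x • mlieBracket 𝓘(ℝ, E) U (mlieBracket 𝓘(ℝ, E) V W) x) := by
    have hVf : MDifferentiableAt 𝓘(ℝ, E) 𝓘(ℝ, ℝ) (dirDeriv V f) x :=
      (contMDiff_dirDeriv V hf x).mdifferentiableAt (by simp)
    refine (Filter.EventuallyEq.mlieBracket_vectorField_eq
      (Filter.EventuallyEq.refl _ _) (hb V)).trans ?_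
    rw [mlieBracket_add_right (hVf.smul_section hWd) ((hfd x).smul_section (hB V)),
      mlieBracket_smul_right hVf hWd, mlieBracket_smul_right (hfd x) (hB V)]
    rfl
  have h2 : minSmoothness ℝ 2 ≤ ∞ := by simpa using! ENat.LEInfty.out (m := 2)
  have hX2 := (X.contMDiff x).of_le h2
  have hY2 := (Y.contMDiff x).of_le h2
  have j1 := leibniz_identity_mlieBracket_apply hX2 hY2 (hfW.of_le h2)
  have j2 := leibniz_identity_mlieBracket_apply hX2 hY2 (hW.of_le h2)
  have j3 : mlieBracket 𝓘(ℝ, E) (mlieBracket 𝓘(ℝ, E) X Y) (f • W) x =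
      dirDeriv ⁅X, Y⁆ f x • W x +
        f x • mlieBracket 𝓘(ℝ, E) (mlieBracket 𝓘(ℝ, E) X Y) W x :=
    mlieBracket_smul_right (hfd x) hWd
  rw [hbb, hbb, j3, j2, hWx] at j1
  have j4 : (dirDeriv ⁅X, Y⁆ f x -
      (dirDeriv X (dirDeriv Y f) x - dirDeriv Y (dirDeriv X f) x)) • w = 0 := by
    rw [← sub_eq_zero] at j1
    rw [← neg_eq_zero, ← j1]
    module
  exact sub_eq_zero.1 ((smul_eq_zero.1 j4).resolve_right hw)

/-- The exterior derivative `dα`, evaluated on three vector fields. -/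
noncomputable def TwoForm.extDeriv (α : TwoForm E M) (X Y Z : SmoothVectorField E M) (x : M) : ℝ :=
  dirDeriv X (α.eval Y Z) x - dirDeriv Y (α.eval X Z) x + dirDeriv Z (α.eval X Y) x
    - α.eval ⁅X, Y⁆ Z x + α.eval ⁅X, Z⁆ Y x - α.eval ⁅Y, Z⁆ X x

/-- The Lie derivative `L_X α`, evaluated on two vector fields `Y`, `Z`. -/
noncomputable def TwoForm.lieDeriv (X : SmoothVectorField E M) (α : TwoForm E M)
    (Y Z : SmoothVectorField E M) (x : M) : ℝ :=
  dirDeriv X (α.eval Y Z) x - α.eval ⁅X, Y⁆ Z x - α.eval Y ⁅X, Z⁆ x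

end Bracket

section Symplectic

variable (E : Type*) [NormedAddCommGroup E] [NormedSpace ℝ E] [FiniteDimensional ℝ E]
  (M : Type*) [TopologicalSpace M] [ChartedSpace E M] [IsManifold 𝓘(ℝ, E) ∞ M]

/-- A symplectic form on `M`: a closed nondegenerate smooth `2`-form. -/
structure SymplecticForm extends TwoForm E M where
  nondegenerate (x : M) (v : TangentSpace 𝓘(ℝ, E) x) : (∀ w, toFun x v w = 0) → v = 0
  closed (X Y Z : SmoothVectorField E M) (x : M) : toTwoForm.extDeriv X Y Z x = 0

variable {E M}

/-- The Lie algebra `𝔛(M, [Ω])` of conformally symplectic vector fields: those `X` for which there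
is a real constant `c` with `L_X Ω = c Ω`. -/
noncomputable def conformallySymplectic (Ω : SymplecticForm E M) :
    LieSubalgebra ℝ (SmoothVectorField E M) where
  carrier := {X | ∃ c : ℝ, ∀ (Y Z : SmoothVectorField E M) (x : M),
    Ω.lieDeriv X Y Z x = c * Ω.eval Y Z x}
  zero_mem' := by
    refine ⟨0, fun Y Z x => ?_⟩
    simp [TwoForm.lieDeriv, dirDeriv, TwoForm.eval]
  add_mem' := by
    rintro X X' ⟨c, hc⟩ ⟨c', hc'⟩
    refine ⟨c + c', fun Y Z x => ?_⟩
    have h := hc Y Z x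
    have h' := hc' Y Z x
    simp only [TwoForm.lieDeriv, dirDeriv, TwoForm.eval, add_lie, ContMDiffSection.coe_add,
      Pi.add_apply, map_add, add_apply] at h h' ⊢
    linarith
  smul_mem' := by
    rintro a X ⟨c, hc⟩
    refine ⟨a * c, fun Y Z x => ?_⟩
    have h := hc Y Z x
    simp only [TwoForm.lieDeriv, dirDeriv, TwoForm.eval, smul_lie, ContMDiffSection.coe_smul,
      Pi.smul_apply, map_smul, smul_apply, smul_eq_mul] at h ⊢
    linear_combination a * h
  lie_mem' := by
    rintro X X' ⟨c, hc⟩ ⟨c', hc'⟩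
    refine ⟨0, fun Y Z x => ?_⟩
    have hd (U V : SmoothVectorField E M) (y : M) :
        MDifferentiableAt 𝓘(ℝ, E) 𝓘(ℝ, ℝ) (Ω.eval U V) y :=
      (Ω.contMDiff_eval U V y).mdifferentiableAt (by simp)
    have key (T : SmoothVectorField E M) (a : ℝ) (h : ∀ (Y Z : SmoothVectorField E M) (x : M),
        Ω.lieDeriv T Y Z x = a * Ω.eval Y Z x) (Y Z : SmoothVectorField E M) :
        dirDeriv T (Ω.eval Y Z) =
          (fun _ => a) * Ω.eval Y Z + Ω.eval ⁅T, Y⁆ Z + Ω.eval Y ⁅T, Z⁆ := by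
      funext y
      have := h Y Z y
      simp only [TwoForm.lieDeriv] at this
      simp only [Pi.add_apply, Pi.mul_apply]
      linarith
    have key2 (S T : SmoothVectorField E M) (a b : ℝ)
        (hS : ∀ (Y Z : SmoothVectorField E M) (x : M), Ω.lieDeriv S Y Z x = a * Ω.eval Y Z x)
        (hT : ∀ (Y Z : SmoothVectorField E M) (x : M), Ω.lieDeriv T Y Z x = b * Ω.eval Y Z x) :
        dirDeriv S (dirDeriv T (Ω.eval Y Z)) x =
          b * dirDeriv S (Ω.eval Y Z) x + dirDeriv S (Ω.eval ⁅T, Y⁆ Z) x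
            + dirDeriv S (Ω.eval Y ⁅T, Z⁆) x := by
      rw [key T b hT]
      simp only [dirDeriv]
      rw [mvfderiv_add (((mdifferentiableAt_const).mul (hd _ _ _)).add (hd _ _ _)) (hd _ _ _),
        mvfderiv_add ((mdifferentiableAt_const).mul (hd _ _ _)) (hd _ _ _),
        mvfderiv_mul mdifferentiableAt_const (hd _ _ _)]
      simp [mvfderiv_const]
    have e1 := key2 X X' c c' hc hc'
    have e2 := key2 X' X c' c hc' hc
    have e3 := dirDeriv_bracket X X' (Ω.contMDiff_eval Y Z) x
    rw [e1, e2, key X c hc, key X c hc, key X c hc, key X' c' hc', key X' c' hc',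
      key X' c' hc'] at e3
    simp only [TwoForm.lieDeriv, e3, lie_lie, Pi.add_apply, Pi.mul_apply]
    simp only [TwoForm.eval, ContMDiffSection.coe_sub, Pi.sub_apply, map_sub,
      sub_apply]
    ring

end Symplectic

end SymplecticManifold

/-!
Write `X_f` for the Hamiltonian vector field of `f`. Let `V` be a vector field such that all the
brackets `[V, X_f]` are conformally symplectic modulo a finite-dimensional space. Cutting `f` off
near many different points gives more fields `[V, X_g]` than the codimension allows, so on any open
set there are a `g` agreeing with `f` near one point and vanishing near another, and a constant `c`,
with `L_{[V, X_g]} Ω = c Ω`. The second point gives `c = 0`, and the first one then shows that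
`L_{[V, X_f]} Ω = 0`.

Hence `β = L_V Ω` is invariant under every `X_f`. Invariance under `X_{f²} = 2 f X_f` yields
`df ∧ i_{X_f} β = 0`; as `df = i_{X_f} Ω` and the values of Hamiltonian fields fill the tangent
spaces, `i_v β` is a multiple of `i_v Ω` for every tangent vector `v`, which forces `β = c Ω` for a
function `c`. Then `X_f c = 0` for all `f`, so that `c` is constant.
-/

namespace SymplecticManifold

section ContinuousLinearMap

variable {𝕜 : Type*} [NontriviallyNormedField 𝕜] [CompleteSpace 𝕜]
  {E : Type*} [NormedAddCommGroup E] [NormedSpace 𝕜 E]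
  {H : Type*} [TopologicalSpace H] {I : ModelWithCorners 𝕜 E H}
  {M : Type*} [TopologicalSpace M] [ChartedSpace H M]
  {F₁ : Type*} [NormedAddCommGroup F₁] [NormedSpace 𝕜 F₁] [FiniteDimensional 𝕜 F₁]
  {F₂ : Type*} [NormedAddCommGroup F₂] [NormedSpace 𝕜 F₂]
  {n : WithTop ℕ∞}

theorem contMDiffAt_clm_of_apply {φ : M → F₁ →L[𝕜] F₂} {x : M}
    (h : ∀ v, ContMDiffAt I 𝓘(𝕜, F₂) n (fun y => φ y v) x) :
    ContMDiffAt I 𝓘(𝕜, F₁ →L[𝕜] F₂) n φ x := by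
  let e := ContinuousLinearEquiv.ofFinrankEq (𝕜 := 𝕜) (E := F₁)
    (F := Fin (Module.finrank 𝕜 F₁) → 𝕜) (by simp)
  let e' := (e.arrowCongr (1 : F₂ ≃L[𝕜] F₂)).trans (ContinuousLinearEquiv.piRing _)
  have he' : ContMDiffAt I 𝓘(𝕜, Fin (Module.finrank 𝕜 F₁) → F₂) n (e' ∘ φ) x :=
    contMDiffAt_pi_space.2 fun i => h _
  simpa [Function.comp_def] using
    (e'.symm : (_ → F₂) →L[𝕜] F₁ →L[𝕜] F₂).contMDiff.contMDiffAt.comp x he'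

end ContinuousLinearMap

section VectorBundle

variable {E : Type*} [NormedAddCommGroup E] [NormedSpace ℝ E]
  {H : Type*} [TopologicalSpace H] {I : ModelWithCorners ℝ E H}
  {M : Type*} [TopologicalSpace M] [ChartedSpace H M]
  {F₁ : Type*} [NormedAddCommGroup F₁] [NormedSpace ℝ F₁]
  {V₁ : M → Type*} [TopologicalSpace (Bundle.TotalSpace F₁ V₁)]
  [∀ x, AddCommGroup (V₁ x)] [∀ x, Module ℝ (V₁ x)] [∀ x, TopologicalSpace (V₁ x)]
  [FiberBundle F₁ V₁] [VectorBundle ℝ F₁ V₁]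
  {F₂ : Type*} [NormedAddCommGroup F₂] [NormedSpace ℝ F₂]
  {V₂ : M → Type*} [TopologicalSpace (Bundle.TotalSpace F₂ V₂)]
  [∀ x, AddCommGroup (V₂ x)] [∀ x, Module ℝ (V₂ x)] [∀ x, TopologicalSpace (V₂ x)]
  [FiberBundle F₂ V₂] [VectorBundle ℝ F₂ V₂]
  [∀ x, IsTopologicalAddGroup (V₂ x)] [∀ x, ContinuousSMul ℝ (V₂ x)]

theorem contMDiffAt_of_isInvertible_apply [CompleteSpace F₁] {n : WithTop ℕ∞}
    {φ : ∀ x, V₁ x →L[ℝ] V₂ x} {σ : ∀ x, V₁ x} {x : M}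
    (hφ : ContMDiffAt I (I.prod 𝓘(ℝ, F₁ →L[ℝ] F₂)) n (fun y => Bundle.TotalSpace.mk'
      (F₁ →L[ℝ] F₂) (E := fun x => V₁ x →L[ℝ] V₂ x) y (φ y)) x)
    (hinv : ∀ᶠ y in nhds x, (φ y).IsInvertible)
    (hφσ : CMDiffAt n (T% fun y => φ y (σ y)) x) : CMDiffAt n (T% σ) x := by
  rw [Bundle.contMDiffAt_section] at hφσ ⊢
  let e₁ := trivializationAt F₁ V₁ x
  let e₂ := trivializationAt F₂ V₂ x
  let A : M → F₁ →L[ℝ] F₂ := fun y => ContinuousLinearMap.inCoordinates F₁ V₁ F₂ V₂ x y x y (φ y)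
  have hA : ContMDiffAt I 𝓘(ℝ, F₁ →L[ℝ] F₂) n A x := ((contMDiffAt_hom_bundle _).1 hφ).2
  have hcoord : ∀ᶠ y in nhds x,
      (A y).IsInvertible ∧ A y (e₁ ⟨y, σ y⟩).2 = (e₂ ⟨y, φ y (σ y)⟩).2 := by
    filter_upwards [hinv, e₁.open_baseSet.mem_nhds (FiberBundle.mem_baseSet_trivializationAt' x),
      e₂.open_baseSet.mem_nhds (FiberBundle.mem_baseSet_trivializationAt' x)] with y hy h₁ h₂
    simp only [A, ContinuousLinearMap.inCoordinates_eq h₁ h₂]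
    refine ⟨.comp ⟨_, rfl⟩ (.comp hy ⟨_, rfl⟩), ?_⟩
    simp [e₁, e₂, h₁]
  have hAinv : ContMDiffAt I 𝓘(ℝ, F₂ →L[ℝ] F₁) n (fun y => (A y).inverse) x :=
    hcoord.self_of_nhds.1.contDiffAt_map_inverse.contMDiffAt.comp x hA
  refine (hAinv.clm_apply hφσ).congr_of_eventuallyEq ?_
  filter_upwards [hcoord] with y ⟨hy, hyσ⟩
  rw [← hyσ, hy.inverse_apply_self]

variable [FiniteDimensional ℝ E] [IsManifold I ∞ M] [T2Space M]

theorem exists_contMDiffSection_eventuallyEq {x : M} {U : Set M} (hU : U ∈ nhds x) {σ : ∀ y, V₁ y}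
    (hσ : CMDiff[U] ∞ (T% σ)) :
    ∃ s : ContMDiffSection I F₁ ∞ V₁, ∀ᶠ y in nhds x, s y = σ y := by
  obtain ⟨t, htU, ht, hxt⟩ := mem_nhds_iff.1 hU
  obtain ⟨χ, -, hχ⟩ := (SmoothBumpFunction.nhds_basis_tsupport (I := I) x).mem_iff.1
    (ht.mem_nhds hxt)
  refine ⟨⟨(χ : M → ℝ) • σ, ContMDiffOn.smul_section_of_tsupport χ.contMDiff.contMDiffOn ht hχ
    (hσ.mono htU)⟩, ?_⟩
  filter_upwards [χ.eventuallyEq_one] with y hy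
  change χ y • σ y = σ y
  rw [hy, Pi.one_apply, one_smul]

variable [ContMDiffVectorBundle ∞ F₁ V₁ I]

theorem exists_contMDiffSection_apply_eq (x : M) (v : V₁ x) :
    ∃ s : ContMDiffSection I F₁ ∞ V₁, s x = v := by
  obtain ⟨U, hU, hσ⟩ := FiberBundle.exists_contMDiffOn_extend (k := ∞) I F₁ v
  obtain ⟨s, hs⟩ := exists_contMDiffSection_eventuallyEq hU hσ
  exact ⟨s, by rw [hs.self_of_nhds, FiberBundle.extend_apply_self]⟩

theorem contMDiff_clm_section_of_apply [FiniteDimensional ℝ F₁] {φ : ∀ x, V₁ x →L[ℝ] V₂ x}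
    (hφ : ∀ s : ContMDiffSection I F₁ ∞ V₁, CMDiff ∞ (T% fun x => φ x (s x))) :
    ContMDiff I (I.prod 𝓘(ℝ, F₁ →L[ℝ] F₂)) ∞ fun x => Bundle.TotalSpace.mk'
      (F₁ →L[ℝ] F₂) (E := fun x => V₁ x →L[ℝ] V₂ x) x (φ x) := by
  intro x
  refine (contMDiffAt_hom_bundle _).2 ⟨contMDiffAt_id, contMDiffAt_clm_of_apply fun v => ?_⟩
  let e₁ := trivializationAt F₁ V₁ x
  let e₂ := trivializationAt F₂ V₂ x
  have hx₁ : x ∈ e₁.baseSet := FiberBundle.mem_baseSet_trivializationAt' x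
  have hx₂ : x ∈ e₂.baseSet := FiberBundle.mem_baseSet_trivializationAt' x
  obtain ⟨U, hU, hU'⟩ :=
    FiberBundle.exists_contMDiffOn_extend (k := ∞) I F₁ (e₁.symm x v)
  obtain ⟨s, hs⟩ := exists_contMDiffSection_eventuallyEq hU hU'
  refine ((Bundle.contMDiffAt_section x).1 (hφ s x)).congr_of_eventuallyEq ?_
  filter_upwards [hs, e₁.open_baseSet.mem_nhds hx₁, e₂.open_baseSet.mem_nhds hx₂] with y hy h₁ h₂
  have hsy : s y = e₁.symm y v := by
    rw [hy, FiberBundle.extend, e₁.apply_mk_symm hx₁]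
  rw [ContinuousLinearMap.inCoordinates_eq h₁ h₂, hsy]
  simp [e₁, e₂]

end VectorBundle

section LinearAlgebra

theorem not_linearIndependent_of_apply_mul_apply_eq {R V : Type*} [CommRing R] [Nontrivial R]
    [TopologicalSpace R] [IsTopologicalRing R] [AddCommGroup V] [Module R V] [TopologicalSpace V]
    {l m : V →L[R] R} (h : ∀ v w, l v * m w = l w * m v) : ¬ LinearIndependent R ![l, m] := by
  intro hlm
  refine hlm.ne_zero 0 (ContinuousLinearMap.ext fun v => ?_)
  refine (LinearIndependent.pair_iff.1 hlm (-m v) (l v) ?_).2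
  ext w
  simpa [neg_add_eq_zero, mul_comm] using h w v

theorem exists_eq_smul_of_forall_not_linearIndependent {K V W : Type*} [Field K]
    [AddCommGroup V] [Module K V] [AddCommGroup W] [Module K W] (a : V ≃ₗ[K] W) (b : V →ₗ[K] W)
    (h : ∀ v, ¬ LinearIndependent K ![a v, b v]) : ∃ c : K, b = c • (a : V →ₗ[K] W) := by
  obtain ⟨c, hc⟩ := LinearMap.exists_eq_smul_id_of_forall_notLinearIndependent
    (f := a.symm.toLinearMap ∘ₗ b) fun v hv => h v <| by
      convert! hv.map' a.toLinearMap a.ker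
      ext i
      fin_cases i <;> simp
  exact ⟨c, LinearMap.ext fun v => a.symm.injective (by simpa using LinearMap.congr_fun hc v)⟩

end LinearAlgebra

section Localization

variable {E : Type*} [NormedAddCommGroup E] [NormedSpace ℝ E]
  {H : Type*} [TopologicalSpace H] {I : ModelWithCorners ℝ E H}
  {M : Type*} [TopologicalSpace M] [ChartedSpace H M] [FiniteDimensional ℝ E] [IsManifold I ∞ M]
  [T2Space M] {F : Type*} [NormedAddCommGroup F] [NormedSpace ℝ F]

theorem exists_contMDiffMap_eventuallyEq {f : M → F} {U : Set M} {p : M} (hU : U ∈ nhds p)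
    (hf : ContMDiffOn I 𝓘(ℝ, F) ∞ f U) :
    ∃ g : C^∞⟮I, M; 𝓘(ℝ, F), F⟯, ⇑g =ᶠ[nhds p] f ∧ ∀ q ∉ U, ⇑g =ᶠ[nhds q] 0 := by
  obtain ⟨t, htU, ht, hpt⟩ := mem_nhds_iff.1 hU
  obtain ⟨χ, -, hχ⟩ := (SmoothBumpFunction.nhds_basis_tsupport (I := I) p).mem_iff.1
    (ht.mem_nhds hpt)
  have hsmooth : ContMDiff I 𝓘(ℝ, F) ∞ fun y => χ y • f y :=
    contMDiff_of_tsupport fun y hy => χ.contMDiff.contMDiffAt.smul <|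
      (hf.mono htU).contMDiffAt (ht.mem_nhds (hχ (tsupport_smul_subset_left _ _ hy)))
  refine ⟨⟨_, hsmooth⟩, ?_, fun q hq => ?_⟩
  · filter_upwards [χ.eventuallyEq_one] with y hy
    simp [hy]
  · filter_upwards [notMem_tsupport_iff_eventuallyEq.1 fun h => hq (htU (hχ h))] with y hy
    simp [hy]

theorem exists_contMDiffMap_eventuallyEq_and_forall_eventuallyEq_zero
    (f : C^∞⟮I, M; 𝓘(ℝ, F), F⟯) (t : Finset M) (p : M) :
    ∃ g : C^∞⟮I, M; 𝓘(ℝ, F), F⟯, ⇑g =ᶠ[nhds p] f ∧ ∀ r ∈ t, r ≠ p → ⇑g =ᶠ[nhds r] 0 := by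
  classical
  have hp : ((t.erase p : Finset M) : Set M)ᶜ ∈ nhds p :=
    (t.erase p).finite_toSet.isClosed.isOpen_compl.mem_nhds (by simp)
  obtain ⟨g, hgf, hg⟩ := exists_contMDiffMap_eventuallyEq hp f.contMDiff.contMDiffOn
  exact ⟨g, hgf, fun r hr hrp => hg r (by simp [hr, hrp])⟩

theorem exists_map_eq_zero_eventuallyEq {Q : Type*} [AddCommGroup Q] [Module ℝ Q]
    [FiniteDimensional ℝ Q] (T : C^∞⟮I, M; 𝓘(ℝ, F), F⟯ →ₗ[ℝ] Q) (f : C^∞⟮I, M; 𝓘(ℝ, F), F⟯)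
    {U : Set M} (hU : U.Infinite) :
    ∃ g, T g = 0 ∧ (∃ p ∈ U, ⇑g =ᶠ[nhds p] f) ∧ ∃ q ∈ U, ⇑g =ᶠ[nhds q] 0 := by
  classical
  obtain ⟨t, htU, ht⟩ := hU.exists_subset_card_eq (Module.finrank ℝ Q + 2)
  obtain ⟨q, hq⟩ : t.Nonempty := Finset.card_pos.1 (by omega)
  choose g hgf hg using exists_contMDiffMap_eventuallyEq_and_forall_eventuallyEq_zero f t
  have hdep : ¬ LinearIndependent ℝ fun r : t.erase q => T (g r) := fun h => by
    have := h.fintype_card_le_finrank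
    simp [hq, ht] at this
  obtain ⟨a, ha, p, hap⟩ := Fintype.not_linearIndependent_iff.1 hdep
  have hpt : p.1 ∈ t := Finset.mem_of_mem_erase p.2
  have hsum (y : M) : (∑ r, a r • g r : C^∞⟮I, M; 𝓘(ℝ, F), F⟯) y = ∑ r, a r • g r y := by
    simpa using! congrFun (map_sum ContMDiffMap.coeFnAddMonoidHom (fun r => a r • g r) _) y
  have hg₀ (p : M) (hp : p ∈ t) : ∀ᶠ y in nhds p, ∀ r : t.erase q, r.1 ≠ p → g r y = 0 :=
    Filter.eventually_all.2 fun r =>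
      Filter.eventually_imp_distrib_left.2 fun hr => hg r p hp hr.symm
  refine ⟨(a p)⁻¹ • ∑ r, a r • g r, ?_, ⟨p, htU hpt, ?_⟩, q, htU hq, ?_⟩
  · rw [map_smul, map_sum]
    simp only [map_smul, ha, smul_zero]
  · filter_upwards [hgf p, hg₀ p hpt] with y hyf hy
    rw [ContMDiffMap.coe_smul, Pi.smul_apply, hsum, Finset.sum_eq_single p (fun r _ hr => by
      rw [hy r (Subtype.coe_ne_coe.2 hr), smul_zero]) (by simp), hyf, inv_smul_smul₀ hap]
  · filter_upwards [hg₀ q hq] with y hy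
    rw [ContMDiffMap.coe_smul, Pi.smul_apply, hsum, Finset.sum_eq_zero fun r _ => by
      rw [hy r (Finset.ne_of_mem_erase r.2), smul_zero], smul_zero, Pi.zero_apply]

end Localization

section Charted

variable {E : Type*} [NormedAddCommGroup E] [NormedSpace ℝ E]
  {M : Type*} [TopologicalSpace M] [ChartedSpace E M]

theorem infinite_of_mem_nhds_of_chartedSpace [Nontrivial E] {x : M} {U : Set M} (hU : U ∈ nhds x) :
    U.Infinite := by
  have h := (chartAt E x).image_mem_nhds (mem_chart_source E x) hU
  have : (nhdsWithin (chartAt E x x) {chartAt E x x}ᶜ).NeBot := Module.punctured_nhds_neBot ℝ E _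
  exact (infinite_of_mem_nhds _ h).of_image _

theorem exists_mvfderiv_eq [FiniteDimensional ℝ E] [IsManifold 𝓘(ℝ, E) ∞ M] [T2Space M] (x : M)
    (l : TangentSpace 𝓘(ℝ, E) x →L[ℝ] ℝ) :
    ∃ f : C^∞⟮𝓘(ℝ, E), M; ℝ⟯, mvfderiv 𝓘(ℝ, E) f x = l := by
  let l' : E →L[ℝ] ℝ := l
  obtain ⟨f, hf, -⟩ := exists_contMDiffMap_eventuallyEq
    ((chartAt E x).open_source.mem_nhds (mem_chart_source E x))
    (l'.contMDiff.comp_contMDiffOn (contMDiffOn_extChartAt (I := 𝓘(ℝ, E)) (x := x) (n := ∞)))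
  refine ⟨f, ?_⟩
  have hext := (mdifferentiableAt_extChartAt (I := 𝓘(ℝ, E)) (mem_chart_source E x)).hasMFDerivAt
  rw [mfderiv_extChartAt_self] at hext
  have hl := (HasMFDerivAt.comp x l'.hasMFDerivAt hext).congr_of_eventuallyEq hf
  exact hl.mfderiv.trans (ContinuousLinearMap.comp_id l')

theorem isLocallyConstant_of_mvfderiv_eq_zero [IsManifold 𝓘(ℝ, E) 1 M] {F : Type*}
    [NormedAddCommGroup F] [NormedSpace ℝ F] {c : M → F} (hc : MDifferentiable 𝓘(ℝ, E) 𝓘(ℝ, F) c)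
    (h₀ : ∀ x, mvfderiv 𝓘(ℝ, E) c x = 0) : IsLocallyConstant c := by
  rw [IsLocallyConstant.iff_eventually_eq]
  intro x
  let φ := extChartAt 𝓘(ℝ, E) x
  have hd (z) (hz : z ∈ φ.target) : HasFDerivAt (c ∘ φ.symm) (0 : E →L[ℝ] F) z := by
    have hφ : MDifferentiableAt 𝓘(ℝ, E) 𝓘(ℝ, E) φ.symm z :=
      ((contMDiffOn_extChartAt_symm (I := 𝓘(ℝ, E)) (n := 1) x).contMDiffAt
        ((isOpen_extChartAt_target x).mem_nhds hz)).mdifferentiableAt one_ne_zero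
    have hcz : HasMFDerivAt 𝓘(ℝ, E) 𝓘(ℝ, F) c (φ.symm z) (0 : E →L[ℝ] F) := by
      have h : mfderiv 𝓘(ℝ, E) 𝓘(ℝ, F) c (φ.symm z) = (0 : E →L[ℝ] F) := h₀ (φ.symm z)
      exact h ▸ (hc (φ.symm z)).hasMFDerivAt
    exact hasMFDerivAt_iff_hasFDerivAt.1 (hcz.comp z hφ.hasMFDerivAt)
  obtain ⟨r, hr, hball⟩ := Metric.isOpen_iff.1 (isOpen_extChartAt_target x) (φ x)
    (mem_extChartAt_target x)
  filter_upwards [(continuousAt_extChartAt (I := 𝓘(ℝ, E)) x).preimage_mem_nhds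
    (Metric.ball_mem_nhds _ hr), extChartAt_source_mem_nhds (I := 𝓘(ℝ, E)) x] with y hy hys
  have hcst := (convex_ball (φ x) r).is_const_of_fderivWithin_eq_zero (𝕜 := ℝ) (f := c ∘ φ.symm)
    (fun z hz => (hd z (hball hz)).differentiableAt.differentiableWithinAt)
    (fun z hz => by
      rw [fderivWithin_of_isOpen Metric.isOpen_ball hz, (hd z (hball hz)).fderiv])
    hy (Metric.mem_ball_self hr)
  rwa [Function.comp_apply, Function.comp_apply, φ.left_inv hys,
    φ.left_inv (mem_extChartAt_source x)] at hcst

end Charted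

section VectorFields

variable {E : Type*} [NormedAddCommGroup E] [NormedSpace ℝ E]
  {M : Type*} [TopologicalSpace M] [ChartedSpace E M] [IsManifold 𝓘(ℝ, E) ∞ M]

/-- The product of a smooth function and a smooth vector field. -/
noncomputable def SmoothVectorField.fsmul (f : C^∞⟮𝓘(ℝ, E), M; ℝ⟯) (X : SmoothVectorField E M) :
    SmoothVectorField E M :=
  ⟨⇑f • ⇑X, f.contMDiff.smul_section X.contMDiff⟩

theorem dirDeriv_congr {X X' : SmoothVectorField E M} {f f' : M → ℝ} {x : M}
    (hX : X x = X' x) (hf : f =ᶠ[nhds x] f') : dirDeriv X f x = dirDeriv X' f' x := by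
  have hd : mvfderiv 𝓘(ℝ, E) f x = mvfderiv 𝓘(ℝ, E) f' x := hf.mfderiv_eq
  rw [dirDeriv, dirDeriv, hX, hd]

theorem dirDeriv_sub {X : SmoothVectorField E M} {f g : M → ℝ} {x : M}
    (hf : MDifferentiableAt 𝓘(ℝ, E) 𝓘(ℝ, ℝ) f x) (hg : MDifferentiableAt 𝓘(ℝ, E) 𝓘(ℝ, ℝ) g x) :
    dirDeriv X (f - g) x = dirDeriv X f x - dirDeriv X g x := by
  simp [dirDeriv, mvfderiv_sub hf hg]

theorem dirDeriv_mul {X : SmoothVectorField E M} {f g : M → ℝ} {x : M}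
    (hf : MDifferentiableAt 𝓘(ℝ, E) 𝓘(ℝ, ℝ) f x) (hg : MDifferentiableAt 𝓘(ℝ, E) 𝓘(ℝ, ℝ) g x) :
    dirDeriv X (f * g) x = f x * dirDeriv X g x + g x * dirDeriv X f x := by
  simp [dirDeriv, mvfderiv_mul hf hg]

variable [FiniteDimensional ℝ E]

theorem bracket_congr {X X' Y Y' : SmoothVectorField E M} {x : M}
    (hX : ⇑X =ᶠ[nhds x] ⇑X') (hY : ⇑Y =ᶠ[nhds x] ⇑Y') :
    (⇑⁅X, Y⁆ : (y : M) → TangentSpace 𝓘(ℝ, E) y) =ᶠ[nhds x] ⇑⁅X', Y'⁆ :=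
  hX.mlieBracket_vectorField hY

theorem bracket_fsmul_left_apply (f : C^∞⟮𝓘(ℝ, E), M; ℝ⟯) (X Y : SmoothVectorField E M) (x : M) :
    ⁅X.fsmul f, Y⁆ x = -dirDeriv Y f x • X x + f x • ⁅X, Y⁆ x := by
  have : CompleteSpace E := FiniteDimensional.complete ℝ E
  have := isManifold_two (E := E) (M := M)
  exact mlieBracket_smul_left (f.contMDiff.mdifferentiableAt (by simp)) (X.mdifferentiableAt x)

end VectorFields

namespace TwoForm

section Tensoriality

variable {E : Type*} [NormedAddCommGroup E] [NormedSpace ℝ E]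
  {M : Type*} [TopologicalSpace M] [ChartedSpace E M] [IsManifold 𝓘(ℝ, E) ∞ M]

theorem toFun_swap (α : TwoForm E M) {x : M} (v w : TangentSpace 𝓘(ℝ, E) x) :
    α.toFun x v w = -α.toFun x w v := by
  have h := α.alternating x (v + w)
  simp only [map_add, add_apply, α.alternating] at h
  linarith

theorem mdifferentiableAt_apply (α : TwoForm E M) {σ τ : ∀ y : M, TangentSpace 𝓘(ℝ, E) y} {x : M}
    (hσ : MDiffAt (T% σ) x) (hτ : MDiffAt (T% τ) x) :
    MDiffAt (fun y => α.toFun y (σ y) (τ y)) x := by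
  have h := MDifferentiableAt.clm_bundle_apply₂ (E₁ := fun x : M => TangentSpace 𝓘(ℝ, E) x)
    (E₂ := fun x : M => TangentSpace 𝓘(ℝ, E) x) (E₃ := Bundle.Trivial M ℝ) (F₁ := E) (F₂ := E)
    (F₃ := ℝ) (b := id) (ψ := α.toFun) (v := σ) (w := τ)
    ((α.smooth x).mdifferentiableAt (by simp)) hσ hτ
  simp only [mdifferentiableAt_totalSpace] at h
  simpa using! h.2

/-- The Lie derivative `(L_X α)(σ, τ)` at `x`, for vector fields `σ`, `τ` which need not be smooth.
It is tensorial in `σ` and `τ`, so that it defines a `2`-form, see `TwoForm.lieDerivForm`. -/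
noncomputable def lieDerivAt (X : SmoothVectorField E M) (α : TwoForm E M) (x : M)
    (σ τ : ∀ y : M, TangentSpace 𝓘(ℝ, E) y) : ℝ :=
  mvfderiv 𝓘(ℝ, E) (fun y => α.toFun y (σ y) (τ y)) x (X x)
    - α.toFun x (mlieBracket 𝓘(ℝ, E) X σ x) (τ x) - α.toFun x (σ x) (mlieBracket 𝓘(ℝ, E) X τ x)

theorem lieDerivAt_swap (X : SmoothVectorField E M) (α : TwoForm E M) (x : M)
    (σ τ : ∀ y : M, TangentSpace 𝓘(ℝ, E) y) :
    α.lieDerivAt X x σ τ = -α.lieDerivAt X x τ σ := by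
  have h : (fun y => α.toFun y (σ y) (τ y)) = -fun y => α.toFun y (τ y) (σ y) :=
    funext fun y => α.toFun_swap _ _
  rw [lieDerivAt, lieDerivAt, h, mvfderiv_neg, α.toFun_swap (σ x), α.toFun_swap _ (τ x), neg_apply]
  ring

variable [FiniteDimensional ℝ E]

theorem tensorialAt_lieDerivAt_left (X : SmoothVectorField E M) (α : TwoForm E M) {x : M}
    {τ : ∀ y : M, TangentSpace 𝓘(ℝ, E) y} (hτ : MDiffAt (T% τ) x) :
    TensorialAt 𝓘(ℝ, E) E (fun σ => α.lieDerivAt X x σ τ) x := by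
  have : CompleteSpace E := FiniteDimensional.complete ℝ E
  have := isManifold_two (E := E) (M := M)
  constructor
  · intro f σ hf hσ
    have h : (fun y => α.toFun y ((f • σ) y) (τ y)) = f * fun y => α.toFun y (σ y) (τ y) := by
      funext y
      simp
    simp only [lieDerivAt]
    rw [h, mvfderiv_mul hf (α.mdifferentiableAt_apply hσ hτ), mlieBracket_smul_right hf hσ]
    simp only [add_apply, smul_apply, smul_eq_mul, map_add, map_smul, Pi.smul_apply']
    ring
  · intro σ σ' hσ hσ'
    have h : (fun y => α.toFun y ((σ + σ') y) (τ y)) =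
        (fun y => α.toFun y (σ y) (τ y)) + fun y => α.toFun y (σ' y) (τ y) := by
      funext y
      simp
    simp only [lieDerivAt]
    rw [h, mvfderiv_add (α.mdifferentiableAt_apply hσ hτ) (α.mdifferentiableAt_apply hσ' hτ),
      mlieBracket_add_right hσ hσ']
    simp only [add_apply, map_add, Pi.add_apply]
    ring

theorem tensorialAt_lieDerivAt_right (X : SmoothVectorField E M) (α : TwoForm E M) {x : M}
    {σ : ∀ y : M, TangentSpace 𝓘(ℝ, E) y} (hσ : MDiffAt (T% σ) x) :
    TensorialAt 𝓘(ℝ, E) E (α.lieDerivAt X x σ) x := by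
  have h := α.tensorialAt_lieDerivAt_left X hσ
  constructor
  · intro f τ hf hτ
    rw [lieDerivAt_swap, h.smul hf hτ, α.lieDerivAt_swap X x σ τ, smul_neg]
  · intro τ τ' hτ hτ'
    rw [lieDerivAt_swap, h.add hτ hτ', α.lieDerivAt_swap X x σ τ, α.lieDerivAt_swap X x σ τ',
      neg_add]

/-- The value at `x` of the `2`-form `L_X α`. -/
noncomputable def lieDerivHom (X : SmoothVectorField E M) (α : TwoForm E M) (x : M) :
    TangentSpace 𝓘(ℝ, E) x →L[ℝ] TangentSpace 𝓘(ℝ, E) x →L[ℝ] ℝ :=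
  TensorialAt.mkHom₂ (α.lieDerivAt X x) x
    (fun _ => α.tensorialAt_lieDerivAt_left X) (fun _ => α.tensorialAt_lieDerivAt_right X)

theorem lieDerivHom_apply (X : SmoothVectorField E M) (α : TwoForm E M)
    (Y Z : SmoothVectorField E M) (x : M) :
    α.lieDerivHom X x (Y x) (Z x) = α.lieDeriv X Y Z x :=
  TensorialAt.mkHom₂_apply _ _ (Y.mdifferentiableAt x) (Z.mdifferentiableAt x)

theorem contMDiff_lieDeriv (X : SmoothVectorField E M) (α : TwoForm E M)
    (Y Z : SmoothVectorField E M) : ContMDiff 𝓘(ℝ, E) 𝓘(ℝ, ℝ) ∞ (α.lieDeriv X Y Z) :=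
  ((contMDiff_dirDeriv X (α.contMDiff_eval Y Z)).sub (α.contMDiff_eval ⁅X, Y⁆ Z)).sub
    (α.contMDiff_eval Y ⁅X, Z⁆)

/-- The Lie derivative `L_X α` as a `2`-form. -/
noncomputable def lieDerivForm [T2Space M] (X : SmoothVectorField E M) (α : TwoForm E M) :
    TwoForm E M where
  toFun := α.lieDerivHom X
  alternating x v := by
    obtain ⟨Y, rfl⟩ := exists_contMDiffSection_apply_eq (I := 𝓘(ℝ, E)) (F₁ := E)
      (V₁ := fun x : M => TangentSpace 𝓘(ℝ, E) x) x v
    rw [lieDerivHom_apply]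
    exact self_eq_neg.1 (α.lieDerivAt_swap X x Y Y)
  smooth := by
    refine contMDiff_clm_section_of_apply (V₁ := fun x : M => TangentSpace 𝓘(ℝ, E) x)
      (V₂ := fun x : M => TangentSpace 𝓘(ℝ, E) x →L[ℝ] Bundle.Trivial M ℝ x) fun Y => ?_
    refine contMDiff_clm_section_of_apply (V₁ := fun x : M => TangentSpace 𝓘(ℝ, E) x)
      (V₂ := Bundle.Trivial M ℝ) fun Z x => ?_
    rw [Bundle.contMDiffAt_section]
    refine (α.contMDiff_lieDeriv X Y Z x).congr_of_eventuallyEq (.of_forall fun y => ?_)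
    simpa using! α.lieDerivHom_apply X Y Z y

theorem lieDerivForm_eval [T2Space M] (X : SmoothVectorField E M) (α : TwoForm E M)
    (Y Z : SmoothVectorField E M) : (α.lieDerivForm X).eval Y Z = α.lieDeriv X Y Z :=
  funext fun x => α.lieDerivHom_apply X Y Z x

end Tensoriality

section LieDeriv

variable {E : Type*} [NormedAddCommGroup E] [NormedSpace ℝ E] [FiniteDimensional ℝ E]
  {M : Type*} [TopologicalSpace M] [ChartedSpace E M] [IsManifold 𝓘(ℝ, E) ∞ M]

theorem lieDeriv_congr (α : TwoForm E M) {X X' : SmoothVectorField E M} {x : M}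
    (h : ⇑X =ᶠ[nhds x] ⇑X') (Y Z : SmoothVectorField E M) :
    α.lieDeriv X Y Z x = α.lieDeriv X' Y Z x := by
  have hY := (bracket_congr h (.refl _ ⇑Y)).self_of_nhds
  have hZ := (bracket_congr h (.refl _ ⇑Z)).self_of_nhds
  simp only [lieDeriv, eval, dirDeriv_congr h.self_of_nhds (.refl _ _), hY, hZ]

theorem lieDeriv_zero_left (α : TwoForm E M) (Y Z : SmoothVectorField E M) (x : M) :
    α.lieDeriv 0 Y Z x = 0 := by
  simp [lieDeriv, eval, dirDeriv]

theorem lieDeriv_add_left (α : TwoForm E M) (X X' Y Z : SmoothVectorField E M) (x : M) :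
    α.lieDeriv (X + X') Y Z x = α.lieDeriv X Y Z x + α.lieDeriv X' Y Z x := by
  simp only [lieDeriv, dirDeriv, eval, add_lie, ContMDiffSection.coe_add, Pi.add_apply, map_add,
    add_apply]
  ring

theorem lieDeriv_fsmul_left (α : TwoForm E M) (f : C^∞⟮𝓘(ℝ, E), M; ℝ⟯)
    (X Y Z : SmoothVectorField E M) (x : M) :
    α.lieDeriv (X.fsmul f) Y Z x = f x * α.lieDeriv X Y Z x + dirDeriv Y f x * α.eval X Z x
      - dirDeriv Z f x * α.eval X Y x := by
  have hX (g : M → ℝ) : dirDeriv (X.fsmul f) g x = f x * dirDeriv X g x :=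
    map_smul (mvfderiv 𝓘(ℝ, E) g x) (f x) (X x)
  simp only [lieDeriv, hX, eval, bracket_fsmul_left_apply, map_add, map_smul, add_apply, smul_apply,
    smul_eq_mul, α.toFun_swap (Y x) (X x)]
  ring

theorem lieDeriv_of_toFun_eq_smul {α β : TwoForm E M} {c : M → ℝ}
    (h : ∀ y, β.toFun y = c y • α.toFun y) {x : M} (hc : MDifferentiableAt 𝓘(ℝ, E) 𝓘(ℝ, ℝ) c x)
    (X Y Z : SmoothVectorField E M) :
    β.lieDeriv X Y Z x = dirDeriv X c x * α.eval Y Z x + c x * α.lieDeriv X Y Z x := by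
  have heval (A B : SmoothVectorField E M) : β.eval A B = c * α.eval A B :=
    funext fun y => by simp [eval, h]
  simp only [lieDeriv, heval]
  rw [dirDeriv_mul hc ((α.contMDiff_eval Y Z).mdifferentiableAt (by simp))]
  simp only [Pi.mul_apply]
  ring

theorem dirDeriv_lieDeriv (α : TwoForm E M) (X V Y Z : SmoothVectorField E M) (x : M) :
    dirDeriv X (α.lieDeriv V Y Z) x = dirDeriv X (dirDeriv V (α.eval Y Z)) x
      - dirDeriv X (α.eval ⁅V, Y⁆ Z) x - dirDeriv X (α.eval Y ⁅V, Z⁆) x := by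
  have h₁ := (contMDiff_dirDeriv V (α.contMDiff_eval Y Z)).mdifferentiableAt (x := x) (by simp)
  have h₂ := (α.contMDiff_eval ⁅V, Y⁆ Z).mdifferentiableAt (x := x) (by simp)
  have h₃ := (α.contMDiff_eval Y ⁅V, Z⁆).mdifferentiableAt (x := x) (by simp)
  exact (dirDeriv_sub (h₁.sub h₂) h₃).trans (by rw [dirDeriv_sub h₁ h₂])

theorem lieDeriv_bracket [T2Space M] (α : TwoForm E M) (X V Y Z : SmoothVectorField E M) (x : M) :
    α.lieDeriv ⁅X, V⁆ Y Z x =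
      (α.lieDerivForm V).lieDeriv X Y Z x - (α.lieDerivForm X).lieDeriv V Y Z x := by
  rw [lieDeriv, dirDeriv_bracket X V (α.contMDiff_eval Y Z), lieDeriv, lieDeriv]
  simp only [lieDerivForm_eval, dirDeriv_lieDeriv]
  simp only [lieDeriv, lie_lie, eval, ContMDiffSection.coe_sub, Pi.sub_apply, map_sub, sub_apply]
  ring

end LieDeriv

end TwoForm

section Hamiltonian

variable {E : Type*} [NormedAddCommGroup E] [NormedSpace ℝ E] [FiniteDimensional ℝ E]
  {M : Type*} [TopologicalSpace M] [ChartedSpace E M] [IsManifold 𝓘(ℝ, E) ∞ M]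

namespace SymplecticForm

/-- The isomorphism `v ↦ Ω(v, ·)` from the tangent to the cotangent space given by a symplectic
form. -/
noncomputable def flat (Ω : SymplecticForm E M) (x : M) :
    TangentSpace 𝓘(ℝ, E) x ≃L[ℝ] (TangentSpace 𝓘(ℝ, E) x →L[ℝ] ℝ) :=
  let B : E →L[ℝ] E →L[ℝ] ℝ := Ω.toFun x
  (LinearEquiv.ofInjectiveOfFinrankEq B.toLinearMap
    ((injective_iff_map_eq_zero B).2 fun v hv =>
      Ω.nondegenerate x v fun w => congrArg (fun l : E →L[ℝ] ℝ => l w) hv)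
    (Subspace.dual_finrank_eq.symm.trans
      (LinearMap.toContinuousLinearMap (E := E) (F' := ℝ)).finrank_eq)).toContinuousLinearEquiv

theorem toFun_ne_zero [Nontrivial E] (Ω : SymplecticForm E M) (x : M) : Ω.toFun x ≠ 0 := by
  intro h
  obtain ⟨v, hv⟩ := exists_ne (0 : E)
  exact hv (Ω.nondegenerate x v fun w => by rw [h]; rfl)

variable [T2Space M]

theorem contMDiff_flat_symm_mvfderiv (Ω : SymplecticForm E M) {f : M → ℝ}
    (hf : ContMDiff 𝓘(ℝ, E) 𝓘(ℝ, ℝ) ∞ f) :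
    CMDiff ∞ (T% fun x => (Ω.flat x).symm (mvfderiv 𝓘(ℝ, E) f x)) := by
  have : CompleteSpace E := FiniteDimensional.complete ℝ E
  intro x
  refine contMDiffAt_of_isInvertible_apply (F₂ := E →L[ℝ] ℝ)
    (V₂ := fun x : M => TangentSpace 𝓘(ℝ, E) x →L[ℝ] Bundle.Trivial M ℝ x) (φ := Ω.toFun)
    (Ω.smooth x) (.of_forall fun y => ⟨Ω.flat y, rfl⟩) ?_
  have hdf : ContMDiff 𝓘(ℝ, E) (𝓘(ℝ, E).prod 𝓘(ℝ, E →L[ℝ] ℝ)) ∞ fun x => Bundle.TotalSpace.mk'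
      (E →L[ℝ] ℝ) (E := fun x : M => TangentSpace 𝓘(ℝ, E) x →L[ℝ] Bundle.Trivial M ℝ x) x
      (mvfderiv 𝓘(ℝ, E) f x) := by
    refine contMDiff_clm_section_of_apply (V₁ := fun x : M => TangentSpace 𝓘(ℝ, E) x)
      (V₂ := Bundle.Trivial M ℝ) fun Y x => ?_
    rw [Bundle.contMDiffAt_section]
    simpa using! contMDiff_dirDeriv Y hf x
  refine (hdf x).congr_of_eventuallyEq (.of_forall fun y => ?_)
  exact congrArg _ ((Ω.flat y).apply_symm_apply _)

/-- The Hamiltonian vector field `X_f` of `f`, with the sign convention `Ω(X_f, ·) = df`. -/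
noncomputable def hamiltonianField (Ω : SymplecticForm E M) :
    C^∞⟮𝓘(ℝ, E), M; ℝ⟯ →ₗ[ℝ] SmoothVectorField E M where
  toFun f := ⟨_, Ω.contMDiff_flat_symm_mvfderiv f.contMDiff⟩
  map_add' f g := by
    ext x
    change (Ω.flat x).symm (mvfderiv 𝓘(ℝ, E) (⇑f + ⇑g) x) = _
    rw [mvfderiv_add (f.contMDiff.mdifferentiableAt (by simp))
      (g.contMDiff.mdifferentiableAt (by simp)), map_add]
    rfl
  map_smul' a f := by
    ext x
    change (Ω.flat x).symm (mvfderiv 𝓘(ℝ, E) (a • ⇑f) x) = _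
    have h : mvfderiv 𝓘(ℝ, E) (a • ⇑f) x = a • mvfderiv 𝓘(ℝ, E) f x :=
      ((f.contMDiff.mdifferentiableAt (by simp)).hasMFDerivAt.const_smul a).mfderiv
    rw [h, map_smul]
    rfl

theorem flat_hamiltonianField (Ω : SymplecticForm E M) (f : C^∞⟮𝓘(ℝ, E), M; ℝ⟯) (x : M) :
    Ω.flat x (Ω.hamiltonianField f x) = mvfderiv 𝓘(ℝ, E) f x :=
  (Ω.flat x).apply_symm_apply _

theorem eval_hamiltonianField (Ω : SymplecticForm E M) (f : C^∞⟮𝓘(ℝ, E), M; ℝ⟯)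
    (Y : SmoothVectorField E M) : Ω.eval (Ω.hamiltonianField f) Y = dirDeriv Y f :=
  funext fun x => congrArg (fun l : TangentSpace 𝓘(ℝ, E) x →L[ℝ] ℝ => l (Y x))
    (Ω.flat_hamiltonianField f x)

theorem hamiltonianField_congr (Ω : SymplecticForm E M) {f g : C^∞⟮𝓘(ℝ, E), M; ℝ⟯} {x : M}
    (h : ⇑f =ᶠ[nhds x] g) : ⇑(Ω.hamiltonianField f) =ᶠ[nhds x] ⇑(Ω.hamiltonianField g) := by
  filter_upwards [h.eventuallyEq_nhds] with y hy
  apply (Ω.flat y).injective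
  rw [flat_hamiltonianField, flat_hamiltonianField]
  exact hy.mfderiv_eq

theorem hamiltonianField_mul (Ω : SymplecticForm E M) (f g : C^∞⟮𝓘(ℝ, E), M; ℝ⟯) :
    Ω.hamiltonianField (f * g) =
      (Ω.hamiltonianField g).fsmul f + (Ω.hamiltonianField f).fsmul g := by
  ext x
  apply (Ω.flat x).injective
  rw [flat_hamiltonianField, ContMDiffMap.coe_mul,
    mvfderiv_mul (f.contMDiff.mdifferentiableAt (by simp))
      (g.contMDiff.mdifferentiableAt (by simp)), ← flat_hamiltonianField Ω,
    ← flat_hamiltonianField Ω, ← map_smul, ← map_smul, ← map_add]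
  rfl

theorem exists_hamiltonianField_apply_eq (Ω : SymplecticForm E M) (x : M)
    (v : TangentSpace 𝓘(ℝ, E) x) : ∃ f, Ω.hamiltonianField f x = v := by
  obtain ⟨f, hf⟩ := exists_mvfderiv_eq x (Ω.flat x v)
  exact ⟨f, (Ω.flat x).injective ((Ω.flat_hamiltonianField f x).trans hf)⟩

theorem lieDeriv_hamiltonianField (Ω : SymplecticForm E M) (f : C^∞⟮𝓘(ℝ, E), M; ℝ⟯)
    (Y Z : SmoothVectorField E M) (x : M) : Ω.lieDeriv (Ω.hamiltonianField f) Y Z x = 0 := by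
  -- Cartan's formula: `L_{X_f} Ω = d(i_{X_f} Ω) + i_{X_f} dΩ = d(df) + 0`.
  have hclosed := Ω.closed (Ω.hamiltonianField f) Y Z x
  have hddf := dirDeriv_bracket Y Z f.contMDiff x
  rw [← eval_hamiltonianField, TwoForm.eval, Ω.toFun_swap] at hddf
  simp only [TwoForm.extDeriv, eval_hamiltonianField] at hclosed
  rw [TwoForm.eval, TwoForm.eval, TwoForm.eval, Ω.toFun_swap (⁅_, Z⁆ x)] at hclosed
  rw [TwoForm.lieDeriv, TwoForm.eval, TwoForm.eval]
  linarith

theorem hamiltonianField_mem_conformallySymplectic (Ω : SymplecticForm E M)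
    (f : C^∞⟮𝓘(ℝ, E), M; ℝ⟯) : Ω.hamiltonianField f ∈ conformallySymplectic Ω :=
  ⟨0, fun Y Z x => by rw [lieDeriv_hamiltonianField, zero_mul]⟩

end SymplecticForm

end Hamiltonian

section ConformalFactor

variable {E : Type*} [NormedAddCommGroup E] [NormedSpace ℝ E] [FiniteDimensional ℝ E]
  {M : Type*} [TopologicalSpace M] [ChartedSpace E M] [IsManifold 𝓘(ℝ, E) ∞ M] [T2Space M]

namespace TwoForm

theorem exists_eval_ne_zero (α : TwoForm E M) {x : M} (h : α.toFun x ≠ 0) :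
    ∃ Y Z : SmoothVectorField E M, α.eval Y Z x ≠ 0 := by
  obtain ⟨v, hv⟩ := DFunLike.ne_iff.1 h
  obtain ⟨w, hw⟩ := DFunLike.ne_iff.1 hv
  obtain ⟨Y, rfl⟩ := exists_contMDiffSection_apply_eq (I := 𝓘(ℝ, E)) (F₁ := E) x v
  obtain ⟨Z, rfl⟩ := exists_contMDiffSection_apply_eq (I := 𝓘(ℝ, E)) (F₁ := E) x w
  exact ⟨Y, Z, hw⟩

theorem contMDiff_of_toFun_eq_smul {α β : TwoForm E M} {c : M → ℝ}
    (h : ∀ x, β.toFun x = c x • α.toFun x) (hα : ∀ x, α.toFun x ≠ 0) :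
    ContMDiff 𝓘(ℝ, E) 𝓘(ℝ, ℝ) ∞ c := by
  intro x
  obtain ⟨Y, Z, hYZ⟩ := α.exists_eval_ne_zero (hα x)
  refine ((β.contMDiff_eval Y Z x).div₀ (α.contMDiff_eval Y Z x) hYZ).congr_of_eventuallyEq ?_
  filter_upwards [(α.contMDiff_eval Y Z).continuous.continuousAt.eventually_ne hYZ] with y hy
  rw [Pi.div_apply, eq_div_iff hy]
  simp [eval, h]

end TwoForm

namespace SymplecticForm

/-- Invariance of `β` under all Hamiltonian flows, in its infinitesimal form `L_{X_f} β = 0`. -/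
def IsHamiltonianInvariant (Ω : SymplecticForm E M) (β : TwoForm E M) : Prop :=
  ∀ f Y Z x, β.lieDeriv (Ω.hamiltonianField f) Y Z x = 0

namespace IsHamiltonianInvariant

variable {Ω : SymplecticForm E M} {β : TwoForm E M}

theorem dirDeriv_mul_eval_comm (hβ : Ω.IsHamiltonianInvariant β) (f : C^∞⟮𝓘(ℝ, E), M; ℝ⟯)
    (Y Z : SmoothVectorField E M) (x : M) :
    dirDeriv Y f x * β.eval (Ω.hamiltonianField f) Z x =
      dirDeriv Z f x * β.eval (Ω.hamiltonianField f) Y x := by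
  -- As `X_{f²} = 2 f X_f`, this is `2 f L_{X_f} β + 2 df ∧ i_{X_f} β = 0`.
  have h := hβ (f * f) Y Z x
  rw [hamiltonianField_mul, TwoForm.lieDeriv_add_left, TwoForm.lieDeriv_fsmul_left, hβ f] at h
  linarith

theorem exists_toFun_eq_smul (hβ : Ω.IsHamiltonianInvariant β) (x : M) :
    ∃ c : ℝ, β.toFun x = c • Ω.toFun x := by
  obtain ⟨c, hc⟩ := exists_eq_smul_of_forall_not_linearIndependent (Ω.flat x).toLinearEquiv
    (β.toFun x).toLinearMap fun v => by
      obtain ⟨f, rfl⟩ := Ω.exists_hamiltonianField_apply_eq x v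
      refine not_linearIndependent_of_apply_mul_apply_eq fun u w => ?_
      obtain ⟨Y, rfl⟩ := exists_contMDiffSection_apply_eq (I := 𝓘(ℝ, E)) (F₁ := E) x u
      obtain ⟨Z, rfl⟩ := exists_contMDiffSection_apply_eq (I := 𝓘(ℝ, E)) (F₁ := E) x w
      have h := hβ.dirDeriv_mul_eval_comm f Y Z x
      rwa [← eval_hamiltonianField, ← eval_hamiltonianField] at h
  exact ⟨c, ContinuousLinearMap.coe_injective hc⟩

theorem exists_const_toFun_eq_smul [Nontrivial E] [PreconnectedSpace M]
    (hβ : Ω.IsHamiltonianInvariant β) : ∃ c : ℝ, ∀ x, β.toFun x = c • Ω.toFun x := by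
  choose c hc using hβ.exists_toFun_eq_smul
  have hcs : ContMDiff 𝓘(ℝ, E) 𝓘(ℝ, ℝ) ∞ c :=
    TwoForm.contMDiff_of_toFun_eq_smul hc Ω.toFun_ne_zero
  have hcd : MDifferentiable 𝓘(ℝ, E) 𝓘(ℝ, ℝ) c := hcs.mdifferentiable (by simp)
  have hdc (x : M) : mvfderiv 𝓘(ℝ, E) c x = 0 := by
    ext v
    obtain ⟨f, rfl⟩ := Ω.exists_hamiltonianField_apply_eq x v
    obtain ⟨Y, Z, hYZ⟩ := Ω.exists_eval_ne_zero (Ω.toFun_ne_zero x)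
    have h := TwoForm.lieDeriv_of_toFun_eq_smul hc (hcd x) (Ω.hamiltonianField f) Y Z
    rw [hβ, lieDeriv_hamiltonianField, mul_zero, add_zero] at h
    exact (mul_eq_zero.1 h.symm).resolve_right hYZ
  have : IsManifold 𝓘(ℝ, E) 1 M := .of_le (n := ∞) (by simp)
  have hloc := isLocallyConstant_of_mvfderiv_eq_zero hcd hdc
  rcases isEmpty_or_nonempty M with hM | ⟨⟨x₀⟩⟩
  · exact ⟨0, hM.elim⟩
  · exact ⟨c x₀, fun x => by rw [hc, hloc.apply_eq_of_preconnectedSpace x x₀]⟩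

end IsHamiltonianInvariant

theorem lieDeriv_bracket_hamiltonianField (Ω : SymplecticForm E M) (V : SmoothVectorField E M)
    (f : C^∞⟮𝓘(ℝ, E), M; ℝ⟯) (Y Z : SmoothVectorField E M) (x : M) :
    Ω.lieDeriv ⁅V, Ω.hamiltonianField f⁆ Y Z x =
      -(Ω.lieDerivForm V).lieDeriv (Ω.hamiltonianField f) Y Z x := by
  have h (A B : SmoothVectorField E M) : (Ω.lieDerivForm (Ω.hamiltonianField f)).eval A B = 0 :=
    (TwoForm.lieDerivForm_eval ..).trans (funext (Ω.lieDeriv_hamiltonianField f A B))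
  rw [TwoForm.lieDeriv_bracket, TwoForm.lieDeriv, h, h, h]
  simp [dirDeriv, mvfderiv_zero]

end SymplecticForm

end ConformalFactor

section FiniteCodimension

variable {E : Type*} [NormedAddCommGroup E] [NormedSpace ℝ E] [FiniteDimensional ℝ E]
  {M : Type*} [TopologicalSpace M] [ChartedSpace E M] [IsManifold 𝓘(ℝ, E) ∞ M] [T2Space M]
  {Ω : SymplecticForm E M}

theorem lieDeriv_eq_zero_of_mem_conformallySymplectic [Nontrivial E] {X : SmoothVectorField E M}
    (hX : X ∈ conformallySymplectic Ω) {q : M}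
    (hq : ⇑X =ᶠ[nhds q] ⇑(0 : SmoothVectorField E M)) (Y Z : SmoothVectorField E M) (x : M) :
    Ω.lieDeriv X Y Z x = 0 := by
  obtain ⟨c, hc⟩ := hX
  obtain ⟨A, B, hAB⟩ := Ω.exists_eval_ne_zero (Ω.toFun_ne_zero q)
  have h := hc A B q
  rw [TwoForm.lieDeriv_congr _ hq, TwoForm.lieDeriv_zero_left, zero_eq_mul] at h
  rw [hc, h.resolve_right hAB, zero_mul]

theorem lieDeriv_bracket_hamiltonianField_eq_zero [Nontrivial E]
    {W : Submodule ℝ (SmoothVectorField E M)}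
    [FiniteDimensional ℝ (W ⧸ (conformallySymplectic Ω).toSubmodule.submoduleOf W)]
    {V : SmoothVectorField E M} (hV : ∀ f, ⁅V, Ω.hamiltonianField f⁆ ∈ W)
    (f : C^∞⟮𝓘(ℝ, E), M; ℝ⟯) (Y Z : SmoothVectorField E M) (x : M) :
    Ω.lieDeriv ⁅V, Ω.hamiltonianField f⁆ Y Z x = 0 := by
  by_contra hx
  let U : Set M := {y | Ω.lieDeriv ⁅V, Ω.hamiltonianField f⁆ Y Z y ≠ 0}
  have hU : IsOpen U := isOpen_ne_fun (Ω.contMDiff_lieDeriv _ Y Z).continuous continuous_const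
  let T := ((conformallySymplectic Ω).toSubmodule.submoduleOf W).mkQ ∘ₗ
    (LieAlgebra.ad ℝ (SmoothVectorField E M) V ∘ₗ Ω.hamiltonianField).codRestrict W hV
  obtain ⟨g, hg, ⟨p, hp, hgp⟩, q, -, hgq⟩ := exists_map_eq_zero_eventuallyEq T f
    (infinite_of_mem_nhds_of_chartedSpace (E := E) (hU.mem_nhds hx))
  have hgmem : ⁅V, Ω.hamiltonianField g⁆ ∈ conformallySymplectic Ω := by
    rwa [LinearMap.comp_apply, Submodule.mkQ_apply, Submodule.Quotient.mk_eq_zero] at hg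
  have hgerm {g' : C^∞⟮𝓘(ℝ, E), M; ℝ⟯} {y : M} (h : ⇑g =ᶠ[nhds y] g') :
      ⇑⁅V, Ω.hamiltonianField g⁆ =ᶠ[nhds y] ⇑⁅V, Ω.hamiltonianField g'⁆ :=
    bracket_congr (.refl _ _) (Ω.hamiltonianField_congr h)
  have hq : ⇑⁅V, Ω.hamiltonianField g⁆ =ᶠ[nhds q] ⇑(0 : SmoothVectorField E M) := by
    simpa using hgerm (g' := 0) hgq
  apply hp
  rw [← Ω.lieDeriv_congr (hgerm hgp)]
  exact lieDeriv_eq_zero_of_mem_conformallySymplectic hgmem hq Y Z p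

theorem mem_conformallySymplectic_of_lieDeriv_bracket_hamiltonianField [Nontrivial E]
    [PreconnectedSpace M] {V : SmoothVectorField E M}
    (hV : ∀ f Y Z x, Ω.lieDeriv ⁅V, Ω.hamiltonianField f⁆ Y Z x = 0) :
    V ∈ conformallySymplectic Ω := by
  have hinv : Ω.IsHamiltonianInvariant (Ω.lieDerivForm V) := fun f Y Z x => by
    rw [← neg_eq_zero, ← Ω.lieDeriv_bracket_hamiltonianField, hV]
  obtain ⟨c, hc⟩ := hinv.exists_const_toFun_eq_smul
  refine ⟨c, fun Y Z x => ?_⟩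
  rw [← TwoForm.lieDerivForm_eval, TwoForm.eval, hc]
  rfl

end FiniteCodimension

end SymplecticManifold

theorem mainTheorem3_general
    {E : Type*} [NormedAddCommGroup E] [NormedSpace ℝ E] [FiniteDimensional ℝ E]
    {M : Type*} [TopologicalSpace M] [ChartedSpace E M] [IsManifold 𝓘(ℝ, E) ∞ M]
    [T2Space M] [PreconnectedSpace M] (Ω : SymplecticManifold.SymplecticForm E M)
    {W : Submodule ℝ (SymplecticManifold.SmoothVectorField E M)}
    (hW : ∀ V ∈ W, ∀ f, ⁅V, Ω.hamiltonianField f⁆ ∈ W)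
    [FiniteDimensional ℝ
      (W ⧸ (SymplecticManifold.conformallySymplectic Ω).toSubmodule.submoduleOf W)] :
    W ≤ (SymplecticManifold.conformallySymplectic Ω).toSubmodule := by
  intro V hV
  rcases subsingleton_or_nontrivial E with hE | hE
  · have hV₀ : V = 0 := ContMDiffSection.ext fun x => Subsingleton.elim (α := E) _ _
    exact hV₀ ▸ zero_mem _
  · exact SymplecticManifold.mem_conformallySymplectic_of_lieDeriv_bracket_hamiltonianField
      (SymplecticManifold.lieDeriv_bracket_hamiltonianField_eq_zero (hW V hV))

theorem mainTheorem3
    {E : Type*} [NormedAddCommGroup E] [NormedSpace ℝ E] [FiniteDimensional ℝ E]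
    {M : Type*} [TopologicalSpace M] [ChartedSpace E M] [IsManifold 𝓘(ℝ, E) ∞ M]
    [T2Space M] [PreconnectedSpace M]
    (Ω : SymplecticManifold.SymplecticForm E M) :
    ¬ ∃ 𝔤 : LieSubalgebra ℝ (SymplecticManifold.SmoothVectorField E M),
        SymplecticManifold.conformallySymplectic Ω < 𝔤 ∧
        FiniteDimensional ℝ
          (𝔤.toSubmodule ⧸
            (SymplecticManifold.conformallySymplectic Ω).toSubmodule.submoduleOf
              𝔤.toSubmodule) := by
  rintro ⟨𝔤, hlt, hfin⟩
  exact hlt.not_ge <| mainTheorem3_general Ω fun V hV f =>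
    𝔤.lie_mem hV (hlt.le (Ω.hamiltonianField_mem_conformallySymplectic f))
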